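/- All trees are finite rooted trees (unordered, non-empty); edges are directed from parent to child, the degree $\deg(v)$ of a node $v$ is its number of children, and a leaf is a node of degree $0$. A tree $U$ contains a subdivision of a tree $T$ (as a subgraph) if there is an injective map $f$ from the nodes of $T$ to the nodes of $U$ together with, for every edge $(a,b)$ of $T$, a downward path in $U$ from $f(a)$ to $f(b)$, such that no inner node of such a path is in the image of $f$ and paths of distinct edges have no inner node in common; equivalently, $f$ is injective and preserves nearest common ancestors. For $n\ge 1$ let $u(n)$ be the minimum number of leaves of a tree that contains a subdivision of every tree with exactly $n$ leaves and no degree-1 nodes, and put $u(0)=0$. A minor-universal tree for trees on $N$ nodes is a tree that contains a subdivision of every tree with $N$ nodes. Then: 1. In every tree, if $n(d)$ denotes the number of nodes of degree $d$, the number of leaves equals $1+\sum_{d\ge 1} n(d)\,(d-1)$. 2. Let $n\ge1$ and $d\ge 2$. Every tree that contains a subdivision of every tree with $n$ leaves and no degree-1 nodes has at least $\sum_{s\ge 2} u\bigl(\lfloor n/((s-1)(d-1)+1)\rfloor\bigr)$ nodes of degree at least $d$. 3. For every $n\ge 1$, $$u(n)\ \ge\ 1+\sum_{s,d\ge 2}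 u\Bigl(\Bigl\lfloor \frac{n}{(s-1)(d-1)+1}\Bigr\rfloor\Bigr).$$ 4. For every real $c$ such that $\sum_{x,y\ge 1}(xy+1)^{-c}>1$ (a sum of positive terms, with value $+\infty$ if it diverges), $u(n)=\Omega(n^{c})$. 5. $\sum_{x,y\ge1}(xy+1)^{-2.174}>1$. Hence $u(n)=\Omega(n^{2.174})$, and the minimum number of nodes of a minor-universal tree for trees on $N$ nodes is $\Omega(N^{2.174})$. -/

import Mathlib

open Filter Asymptotics

/-! Rooted (unordered) trees are Mathlib's `RootedTree`: the order is "is an ancestor of or equal to",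
`⊥` is the root, `a ⋖ b` says that `b` is a child of `a`, and `a ⊓ b` is the nearest common
ancestor. Finiteness is always required separately. -/

/-- The degree of a node: its number of children. -/
noncomputable def deg (T : RootedTree) (v : T) : ℕ := {w : T | v ⋖ w}.ncard

/-- The number of leaves (nodes without children). -/
noncomputable def numLeaves (T : RootedTree) : ℕ := {v : T | deg T v = 0}.ncard

/-- The number of nodes of degree exactly `d`. -/
noncomputable def numDeg (T : RootedTree) (d : ℕ) : ℕ := {v : T | deg T v = d}.ncard

/-- The number of nodes of degree at least `d`. -/
noncomputable def numDegGe (T : RootedTree) (d : ℕ) : ℕ := {v : T | d ≤ deg T v}.ncard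

/-- `f` realises a subdivision of `T` as a subgraph of `U`, edges being directed from parent to child:
distinct nodes of `T` go to distinct nodes of `U`, and every edge `a ⋖ b` of `T` is
represented by a downward path of `U` from `f a` to `f b` (the inner nodes of this unique path are
those of `Set.Ioo (f a) (f b)`), where no inner node of a path is the image of a node of `T`
and the paths of distinct edges share no inner node. -/
structure IsSubdivisionEmbedding (T U : RootedTree) (f : T → U) : Prop where
  injective : Function.Injective f
  path : ∀ a b : T, a ⋖ b → f a < f b
  avoids : ∀ a b x : T, a ⋖ b → f x ∉ Set.Ioo (f a) (f b)
  disjoint : ∀ a b a' b' : T, a ⋖ b → a' ⋖ b' → (a, b) ≠ (a', b') →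
    Disjoint (Set.Ioo (f a) (f b)) (Set.Ioo (f a') (f b'))

/-- `U` contains a subdivision of `T` as a subgraph. -/
def ContainsSubdivision (U T : RootedTree) : Prop :=
  ∃ f : T → U, IsSubdivisionEmbedding T U f

/-- Equivalently, there is an injective map of the nodes that preserves nearest common ancestors. -/
theorem containsSubdivision_iff_nca (U T : RootedTree) :
    ContainsSubdivision U T ↔
      ∃ f : T → U, Function.Injective f ∧ ∀ a b : T, f (a ⊓ b) = f a ⊓ f b := by
  constructor
  · rintro ⟨f, hf⟩
    refine ⟨f, hf.injective, ?_⟩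
    have hpred : ∀ x : T, f (Order.pred x) ≤ f x := by
      intro x
      by_cases hx : IsMin x
      · rw [hx.pred_eq]
      · exact (hf.path _ _ (Order.pred_covBy_of_not_isMin hx)).le
    have hiter : ∀ (k : ℕ) (x : T), f (Order.pred^[k] x) ≤ f x := by
      intro k
      induction k with
      | zero => intro x; exact le_rfl
      | succ k ih => intro x; exact (ih (Order.pred x)).trans (hpred x)
    have hmono : Monotone f := by
      intro a b hab
      obtain ⟨k, rfl⟩ := hab.exists_pred_iterate
      exact hiter k b
    -- the first node after `c` on the way to `a`
    have hchild : ∀ c a : T, c < a → ∃ b, c ⋖ b ∧ b ≤ a := by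
      intro c a hca
      obtain ⟨k, hk⟩ := hca.le.exists_pred_iterate
      induction k generalizing a with
      | zero => exact absurd hk.symm hca.ne
      | succ k ih =>
        have hmin : ¬ IsMin a := hca.not_isMin
        rcases (Order.le_pred_of_lt hca).eq_or_lt with h | h
        · exact ⟨a, h ▸ Order.pred_covBy_of_not_isMin hmin, le_rfl⟩
        · obtain ⟨b, hb, hba⟩ := ih _ h hk
          exact ⟨b, hb, hba.trans (Order.pred_le a)⟩
    intro a b
    apply le_antisymm
    · exact le_inf (hmono inf_le_left) (hmono inf_le_right)
    rcases (inf_le_left : a ⊓ b ≤ a).eq_or_lt with ha | ha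
    · rw [ha]; exact inf_le_left
    rcases (inf_le_right : a ⊓ b ≤ b).eq_or_lt with hb | hb
    · rw [hb]; exact inf_le_right
    obtain ⟨a1, hca, haa⟩ := hchild _ _ ha
    obtain ⟨b1, hcb, hbb⟩ := hchild _ _ hb
    have hne : a1 ≠ b1 := by
      rintro rfl
      exact absurd (le_inf haa hbb) hca.lt.not_ge
    by_contra hlt
    have hm : f (a ⊓ b) < f a ⊓ f b :=
      lt_of_le_not_ge (le_inf (hmono inf_le_left) (hmono inf_le_right)) hlt
    rcases lt_or_le_of_directed (inf_le_left : f a ⊓ f b ≤ f a) (hmono haa) with h1 | h1 <;>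
    rcases lt_or_le_of_directed (inf_le_right : f a ⊓ f b ≤ f b) (hmono hbb) with h2 | h2
    · exact Set.disjoint_left.1 (hf.disjoint _ _ _ _ hca hcb (by simpa using hne)) ⟨hm, h1⟩ ⟨hm, h2⟩
    · exact hf.avoids _ _ b1 hca ⟨hf.path _ _ hcb, h2.trans_lt h1⟩
    · exact hf.avoids _ _ a1 hcb ⟨hf.path _ _ hca, h1.trans_lt h2⟩
    · rcases le_total_of_directed h1 h2 with h | h
      · exact hf.avoids _ _ b1 hca ⟨hf.path _ _ hcb, h.lt_of_ne (hf.injective.ne hne.symm)⟩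
      · exact hf.avoids _ _ a1 hcb ⟨hf.path _ _ hca, h.lt_of_ne (hf.injective.ne hne)⟩
  · rintro ⟨f, hinj, hinf⟩
    have hle : ∀ x y : T, f x ≤ f y ↔ x ≤ y := by
      intro x y
      rw [← inf_eq_left, ← hinf, hinj.eq_iff, inf_eq_left]
    have hlt : ∀ x y : T, f x < f y ↔ x < y := by
      intro x y
      rw [lt_iff_le_not_ge, lt_iff_le_not_ge, hle, hle]
    refine ⟨f, hinj, fun a b h => (hlt _ _).2 h.lt, ?_, ?_⟩
    · rintro a b x h ⟨h1, h2⟩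
      exact h.2 ((hlt _ _).1 h1) ((hlt _ _).1 h2)
    · intro a b a' b' h h' hne
      rw [Set.disjoint_left]
      rintro p ⟨h1, h2⟩ ⟨h1', h2'⟩
      have hp : p ≤ f (b ⊓ b') := by
        rw [hinf]; exact le_inf h2.le h2'.le
      have e : b ⊓ b' = b := inf_le_left.eq_of_not_lt
        fun hh => h.2 ((hlt _ _).1 (h1.trans_le hp)) hh
      have e' : b ⊓ b' = b' := inf_le_right.eq_of_not_lt
        fun hh => h'.2 ((hlt _ _).1 (h1'.trans_le hp)) hh
      have eb : b = b' := e.symm.trans e'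
      subst eb
      exact hne (by rw [← h.pred_eq, ← h'.pred_eq])

/-- `U` contains a subdivision of every finite tree with `n` leaves and no degree-1 nodes. -/
def IsLeafUniversal (U : RootedTree.{0}) (n : ℕ) : Prop :=
  ∀ T : RootedTree.{0}, Finite T → numLeaves T = n → (∀ v : T, deg T v ≠ 1) →
    ContainsSubdivision U T

/-- The least number of leaves of a finite tree that contains a subdivision of every tree with `n`
leaves and no degree-1 nodes. -/
noncomputable def u (n : ℕ) : ℕ :=
  sInf {k : ℕ | ∃ U : RootedTree.{0}, Finite U ∧ IsLeafUniversal U n ∧ numLeaves U = k}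

/-- `U` is a minor-universal tree for (general) trees on `N` nodes. -/
def IsMinorUniversal (U : RootedTree.{0}) (N : ℕ) : Prop :=
  ∀ T : RootedTree.{0}, Finite T → Nat.card T = N → ContainsSubdivision U T

/-- The least number of nodes of a finite minor-universal tree for trees on `N` nodes. -/
noncomputable def minorUniversalSize (N : ℕ) : ℕ :=
  sInf {k : ℕ | ∃ U : RootedTree.{0}, Finite U ∧ IsMinorUniversal U N ∧ Nat.card U = k}

/-! Let `U` be universal for `n` leaves, fix `d ≥ 2` and `j ≥ 1`, and put `m = ⌊n / (j(d-1)+1)⌋ ≥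
1`. Given a tree `T` with `m` leaves and no degree-1 nodes, replace every leaf by a caterpillar with
`j` inner nodes of degree `d`. Each leaf becomes `j(d-1)+1` leaves, so there are at most `n` in all
and `U` contains the result (`IsLeafUniversal.exists_preservesNca_hasChain`). Embeddings do not
lower degrees (`PreservesNca.deg_le`), so `T` is embedded into the set of nodes of `U` from which a
chain of `j` nodes of degree at least `d` descends. This set is closed under ancestors, hence is
itself a tree; it is universal for `m` leaves and so has at least `u m` leaves
(`IsLeafUniversal.u_le_ncard_chainTops`). These leaves have degree at least `d` in `U`, and their
longest descending chain has exactly `j` such nodes, so different `j = s - 1` give disjoint sets.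
Summing over `s` bounds the number of nodes of degree at least `d`; summing over `d` gives the
recurrence, because a node of degree `e ≥ 2` is counted `e - 1` times, as in the leaf/degree
identity.

If the sum of `(xy+1)^(-c)` exceeds 1, so does a finite partial sum. As `⌊n/k⌋ / n → 1/k`, for large
`n` the function `n^c` is at most the corresponding finite sum of its values at `⌊n/k⌋`, and `n^c =
O(u n)` follows by strong induction.

For `c = 2.174` the symmetric double sum is split along the diagonal; each row is bounded by some
leading terms plus a trapezoidal tail, all rounded down to integers over `2^30`. Trees with `n`
leaves and no degree-1 nodes have at most `2n - 1` nodes, which transfers the bound to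
minor-universal trees. -/

/-! ### Rooted trees from parent functions -/

section ParentTree

variable {α : Type} {r : α} {p : α → α}

theorem iterate_add_eq_root (hr : p r = r) {x : α} {k : ℕ} (hk : p^[k] x = r) {m : ℕ}
    (hm : k ≤ m) : p^[m] x = r := by
  obtain ⟨j, rfl⟩ := Nat.exists_eq_add_of_le' hm
  rw [Function.iterate_add_apply, hk, Function.iterate_fixed hr]

/-- A multiple of the period exceeds the number of steps needed to reach the root, and the root is
fixed. This excludes cycles, whence antisymmetry of the ancestor order. -/
theorem eq_root_of_iterate_eq_self (hr : p r = r) (h : ∀ x, ∃ k, p^[k] x = r) {x : α} {k : ℕ}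
    (hk : 0 < k) (hx : p^[k] x = x) : x = r := by
  obtain ⟨m, hm⟩ := h x
  have h1 : p^[k * m] x = x := by
    rw [Function.iterate_mul, Function.iterate_fixed hx]
  rw [← h1, iterate_add_eq_root hr hm (Nat.le_mul_of_pos_left m hk)]

/-- The rooted tree with root `r` and parent function `p`. -/
noncomputable def parentTree (r : α) (p : α → α) (hr : p r = r)
    (h : ∀ x, ∃ k, p^[k] x = r) : RootedTree.{0} :=
  letI : PartialOrder α :=
    { le := fun a b => ∃ k, p^[k] b = a
      le_refl := fun a => ⟨0, rfl⟩
      le_trans := by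
        rintro a b c ⟨i, rfl⟩ ⟨j, rfl⟩
        exact ⟨i + j, Function.iterate_add_apply _ _ _ _⟩
      le_antisymm := by
        rintro a b ⟨i, hi⟩ ⟨j, hj⟩
        rcases Nat.eq_zero_or_pos i with rfl | hpos
        · exact hi.symm
        have hb : b = r := eq_root_of_iterate_eq_self hr h (k := j + i) (by omega)
          (by rw [Function.iterate_add_apply, hi, hj])
        rw [← hi, hb, Function.iterate_fixed hr] }
  haveI key : ∀ a b : α, ∃ k, p^[k] a ≤ b := fun a b => by
    obtain ⟨i, hi⟩ := h a
    obtain ⟨j, hj⟩ := h b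
    exact ⟨i, j, hj.trans hi.symm⟩
  -- The nearest common ancestor is the first node on the way up from `a` that is an ancestor of
  -- `b`.
  letI : SemilatticeInf α :=
    { inf := fun a b => by
        classical exact p^[Nat.find (key a b)] a
      inf_le_left := fun a b => ⟨_, rfl⟩
      inf_le_right := fun a b => by
        classical exact Nat.find_spec (key a b)
      le_inf := by
        classical
        rintro a b c ⟨i, rfl⟩ hc
        have hle : Nat.find (key b c) ≤ i := Nat.find_min' (key b c) hc
        obtain ⟨j, hj⟩ := Nat.exists_eq_add_of_le' hle
        exact ⟨j, by rw [hj, Function.iterate_add_apply]⟩ }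
  letI : OrderBot α := { bot := r, bot_le := h }
  letI : PredOrder α :=
    { pred := p
      pred_le := fun a => ⟨1, rfl⟩
      min_of_le_pred := by
        rintro a ⟨k, hk⟩
        have ha : a = r := eq_root_of_iterate_eq_self hr h (k := k + 1) (by omega) hk
        intro b _
        exact ha ▸ h b
      le_pred_of_lt := by
        rintro a b hab
        obtain ⟨k, hk⟩ := hab.le
        cases k with
        | zero => exact absurd hk.symm hab.ne
        | succ k => exact ⟨k, hk⟩ }
  haveI : IsPredArchimedean α := ⟨fun hab => hab⟩
  { α := α }

end ParentTree

/-! ### Basic facts on rooted trees -/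

section Basic

variable {T U : RootedTree.{0}}

theorem covBy_iff_pred {a b : T} : a ⋖ b ↔ b ≠ ⊥ ∧ Order.pred b = a := by
  constructor
  · intro h
    exact ⟨h.lt.ne_bot, h.pred_eq⟩
  · rintro ⟨h, rfl⟩
    exact Order.pred_covBy_of_not_isMin (by simpa using h)

theorem exists_covBy_le {c a : T} (hca : c < a) : ∃ b, c ⋖ b ∧ b ≤ a := by
  obtain ⟨k, hk⟩ := hca.le.exists_pred_iterate
  induction k generalizing a with
  | zero => exact absurd hk.symm hca.ne
  | succ k ih =>
    have hmin : ¬ IsMin a := hca.not_isMin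
    rcases (Order.le_pred_of_lt hca).eq_or_lt with h | h
    · exact ⟨a, h ▸ Order.pred_covBy_of_not_isMin hmin, le_rfl⟩
    · obtain ⟨b, hb, hba⟩ := ih h hk
      exact ⟨b, hb, hba.trans (Order.pred_le a)⟩

theorem deg_eq_zero_iff [Finite T] {v : T} : deg T v = 0 ↔ ∀ w, ¬ v ⋖ w := by
  rw [deg, Set.ncard_eq_zero (Set.toFinite _)]
  simp [Set.eq_empty_iff_forall_notMem]

theorem exists_leaf_ge [Finite T] (v : T) : ∃ l, v ≤ l ∧ deg T l = 0 := by
  obtain ⟨l, hvl, hl⟩ := Finite.exists_le_maximal (p := fun _ : T => True) (a := v) trivial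
  exact ⟨l, hvl, deg_eq_zero_iff.2 fun w hw => hw.lt.not_ge (hl.2 trivial hw.le)⟩

theorem one_le_numLeaves [Finite T] : 1 ≤ numLeaves T := by
  obtain ⟨l, -, hl⟩ := exists_leaf_ge (⊥ : T)
  exact (Set.ncard_pos (Set.toFinite _)).2 ⟨l, hl⟩

/-- An injective map that preserves nearest common ancestors. -/
def PreservesNca (f : T → U) : Prop :=
  Function.Injective f ∧ ∀ a b : T, f (a ⊓ b) = f a ⊓ f b

namespace PreservesNca

variable {f : T → U}

theorem le_iff (hf : PreservesNca f) {x y : T} : f x ≤ f y ↔ x ≤ y := by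
  rw [← inf_eq_left, ← hf.2, hf.1.eq_iff, inf_eq_left]

theorem lt_iff (hf : PreservesNca f) {x y : T} : f x < f y ↔ x < y := by
  rw [lt_iff_le_not_ge, lt_iff_le_not_ge, hf.le_iff, hf.le_iff]

theorem comp {V : RootedTree.{0}} {g : U → V} (hg : PreservesNca g) (hf : PreservesNca f) :
    PreservesNca (g ∘ f) :=
  ⟨hg.1.comp hf.1, fun a b => by simp [hf.2, hg.2]⟩

/-- Each child `b` of `a` is sent weakly below some child of `f a`. Two children sharing that child
would have a nearest common ancestor strictly below `a`, so they would be equal. -/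
theorem deg_le [Finite U] (hf : PreservesNca f) (a : T) : deg T a ≤ deg U (f a) := by
  have hex : ∀ b : T, ∃ c : U, a ⋖ b → f a ⋖ c ∧ c ≤ f b := by
    intro b
    by_cases h : a ⋖ b
    · obtain ⟨c, hc⟩ := exists_covBy_le (hf.lt_iff.2 h.lt)
      exact ⟨c, fun _ => hc⟩
    · exact ⟨f a, fun h' => absurd h' h⟩
  choose g hg using hex
  refine Set.ncard_le_ncard_of_injOn g (fun b hb => (hg b hb).1) ?_ (Set.toFinite _)
  intro b hb b' hb' hbb
  by_contra hne
  have h1 : g b ≤ f (b ⊓ b') := by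
    rw [hf.2]
    exact le_inf (hg b hb).2 (hbb ▸ (hg b' hb').2)
  have h2 : a < b ⊓ b' := hf.lt_iff.1 ((hg b hb).1.lt.trans_le h1)
  have e : b ⊓ b' = b := inf_le_left.eq_of_not_lt fun hh => hb.2 h2 hh
  have e' : b ⊓ b' = b' := inf_le_right.eq_of_not_lt fun hh => hb'.2 h2 hh
  exact hne (e.symm.trans e')

end PreservesNca

theorem containsSubdivision_iff :
    ContainsSubdivision U T ↔ ∃ f : T → U, PreservesNca f :=
  containsSubdivision_iff_nca U T

theorem ContainsSubdivision.trans {V : RootedTree.{0}} (h : ContainsSubdivision V U)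
    (h' : ContainsSubdivision U T) : ContainsSubdivision V T := by
  rw [containsSubdivision_iff] at *
  obtain ⟨g, hg⟩ := h
  obtain ⟨f, hf⟩ := h'
  exact ⟨g ∘ f, hg.comp hf⟩

/-- Injective maps sending children to children realise a subdivision. -/
theorem containsSubdivision_of_covBy {f : T → U} (hf : Function.Injective f)
    (h : ∀ a b, a ⋖ b → f a ⋖ f b) : ContainsSubdivision U T :=
  ⟨f, hf, fun a b hab => (h a b hab).lt,
    fun a b x hab => by rw [(h a b hab).Ioo_eq]; exact Set.notMem_empty _,
    fun a b a' b' hab _ _ => by rw [(h a b hab).Ioo_eq]; exact Set.empty_disjoint _⟩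

/-- Injective maps that commute with parents preserve nearest
common ancestors. -/
theorem preservesNca_of_pred {f : T → U} (hf : Function.Injective f)
    (hp : ∀ a, f (Order.pred a) = Order.pred (f a)) : PreservesNca f := by
  have hit : ∀ k a, f (Order.pred^[k] a) = Order.pred^[k] (f a) := fun k a =>
    (Function.Semiconj.iterate_right (f := f) (fun x => hp x) k) a
  have hle : ∀ a b, a ≤ b → f a ≤ f b := by
    intro a b hab
    obtain ⟨k, rfl⟩ := hab.exists_pred_iterate
    rw [hit]
    exact Order.pred_iterate_le k _
  refine ⟨hf, fun a b => le_antisymm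
    (le_inf (hle _ _ inf_le_left) (hle _ _ inf_le_right)) ?_⟩
  -- `f a ⊓ f b` is an iterated parent of both `f a` and `f b`, hence the image of an iterated
  -- parent of `a` and of one of `b`; by injectivity these are one common ancestor.
  obtain ⟨i, hi⟩ := (inf_le_left : f a ⊓ f b ≤ f a).exists_pred_iterate
  obtain ⟨j, hj⟩ := (inf_le_right : f a ⊓ f b ≤ f b).exists_pred_iterate
  have e : Order.pred^[i] a = Order.pred^[j] b := by
    apply hf
    rw [hit, hit, hi, hj]
  rw [← hi, ← hit]
  exact hle _ _ (le_inf (Order.pred_iterate_le i a) (e ▸ Order.pred_iterate_le j b))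

/-! ### The leaf / degree identity -/

/-- Every node except the root is the child of exactly one node. -/
theorem sum_deg [Fintype T] : ∑ v : T, deg T v + 1 = Fintype.card T := by
  classical
  have h1 : ∀ v : T, deg T v = ((Finset.univ.filter fun w : T => w ≠ ⊥).filter
      fun w => Order.pred w = v).card := by
    intro v
    rw [deg, ← Set.ncard_coe_finset]
    congr 1
    ext w
    simp [covBy_iff_pred]
  have h2 : (Finset.univ.filter fun w : T => w ≠ ⊥).card = ∑ v : T, deg T v := by
    simp only [h1]
    exact Finset.card_eq_sum_card_fiberwise fun _ _ => Finset.mem_coe.2 (Finset.mem_univ _)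
  rw [← h2, Finset.filter_ne', Finset.card_erase_of_mem (Finset.mem_univ _), Finset.card_univ]
  exact Nat.succ_pred_eq_of_pos (Fintype.card_pos_iff.2 ⟨⊥⟩)

theorem deg_lt_card [Fintype T] (v : T) : deg T v < Fintype.card T := by
  rw [← sum_deg, Nat.lt_succ_iff]
  exact Finset.single_le_sum (f := fun v => deg T v) (fun _ _ => Nat.zero_le _)
    (Finset.mem_univ v)

theorem ncard_setOf [Fintype T] (P : T → Prop) [DecidablePred P] :
    {v : T | P v}.ncard = ∑ v : T, if P v then 1 else 0 := by
  rw [Finset.sum_boole, ← Set.ncard_coe_finset]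
  simp

/-- With truncated subtraction, `(deg v - 1) + 1` is `deg v` except at leaves, where it is one
larger. -/
theorem numLeaves_eq_sum_sub_one [Fintype T] :
    numLeaves T = 1 + ∑ v : T, (deg T v - 1) := by
  have h : ∑ v : T, (deg T v - 1) + ∑ v : T, 1 = ∑ v : T, deg T v + numLeaves T := by
    rw [numLeaves, ncard_setOf, ← Finset.sum_add_distrib, ← Finset.sum_add_distrib]
    refine Finset.sum_congr rfl fun v _ => ?_
    split_ifs <;> omega
  have h2 := sum_deg (T := T)
  simp only [Finset.sum_const, Finset.card_univ, smul_eq_mul, mul_one] at h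
  omega

theorem numLeaves_eq_one_add_sum_numDeg [Finite T] :
    numLeaves T = 1 + ∑ d ∈ Finset.Icc 1 (Nat.card T), numDeg T d * (d - 1) := by
  have := Fintype.ofFinite T
  rw [numLeaves_eq_sum_sub_one, Nat.card_eq_fintype_card]
  simp only [numDeg, ncard_setOf, Finset.sum_mul]
  rw [Finset.sum_comm]
  congr 1
  refine Finset.sum_congr rfl fun v _ => ?_
  have := deg_lt_card v
  rcases Nat.eq_zero_or_pos (deg T v) with h | h
  · rw [h]
    symm
    refine Finset.sum_eq_zero fun d hd => ?_
    rw [if_neg (by have := (Finset.mem_Icc.1 hd).1; omega), zero_mul]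
  · rw [Finset.sum_eq_single (deg T v)]
    · simp
    · intro d _ hd
      rw [if_neg hd.symm, zero_mul]
    · intro h'
      exact absurd (Finset.mem_Icc.2 ⟨h, this.le⟩) h'

/-- A node `v` is counted once for each `d` in `[2, deg v]`, at most `deg v - 1` times; the cut-off
at `n` only loses terms. -/
theorem one_add_sum_numDegGe_le_numLeaves [Finite T] (n : ℕ) :
    1 + ∑ d ∈ Finset.Icc 2 n, numDegGe T d ≤ numLeaves T := by
  have := Fintype.ofFinite T
  rw [numLeaves_eq_sum_sub_one]
  simp only [numDegGe, ncard_setOf]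
  rw [Finset.sum_comm]
  gcongr with v
  rw [Finset.sum_boole]
  calc _ ≤ (Finset.Icc 2 (deg T v)).card := by
        refine Finset.card_le_card fun d => ?_
        simp only [Finset.mem_filter, Finset.mem_Icc]
        omega
    _ = _ := by simp

theorem card_lt_two_mul_numLeaves [Finite T] (h : ∀ v : T, deg T v ≠ 1) :
    Nat.card T < 2 * numLeaves T := by
  have := Fintype.ofFinite T
  rw [Nat.card_eq_fintype_card, numLeaves, ncard_setOf]
  have h1 := sum_deg (T := T)
  have h2 : ∑ v : T, 2 ≤ ∑ v : T, deg T v + 2 * ∑ v : T, if deg T v = 0 then 1 else 0 := by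
    rw [Finset.mul_sum, ← Finset.sum_add_distrib]
    refine Finset.sum_le_sum fun v _ => ?_
    have := h v
    split_ifs <;> omega
  simp only [Finset.sum_const, Finset.card_univ, smul_eq_mul] at h2
  omega

theorem numLeaves_le_card [Finite T] : numLeaves T ≤ Nat.card T :=
  Set.ncard_le_card _

end Basic

section ParentTreeFacts

variable {α : Type} {r : α} {p : α → α} {hr : p r = r} {h : ∀ x, ∃ k, p^[k] x = r}

/-- The identity map from nodes to `parentTree`. -/
def toParentTree (hr : p r = r) (h : ∀ x, ∃ k, p^[k] x = r) (x : α) : parentTree r p hr h := x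

theorem toParentTree_bijective : Function.Bijective (toParentTree hr h) := Function.bijective_id

theorem bot_eq_toParentTree : (⊥ : parentTree r p hr h) = toParentTree hr h r := rfl

theorem pred_toParentTree (x : α) :
    Order.pred (toParentTree hr h x) = toParentTree hr h (p x) := rfl

theorem toParentTree_covBy {x y : α} :
    toParentTree hr h x ⋖ toParentTree hr h y ↔ y ≠ r ∧ p y = x := by
  rw [covBy_iff_pred, bot_eq_toParentTree, pred_toParentTree,
    toParentTree_bijective.1.ne_iff, toParentTree_bijective.1.eq_iff]

theorem deg_toParentTree (x : α) :
    deg (parentTree r p hr h) (toParentTree hr h x) = {y | y ≠ r ∧ p y = x}.ncard := by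
  rw [deg, ← Set.ncard_image_of_injective _ (toParentTree_bijective (hr := hr) (h := h)).1]
  congr 1
  ext w
  obtain ⟨y, rfl⟩ := (toParentTree_bijective (hr := hr) (h := h)).2 w
  simp [toParentTree_covBy, (toParentTree_bijective (hr := hr) (h := h)).1.eq_iff]

end ParentTreeFacts

/-! ### Grafting leaves -/

section Graft

/-- The parent function of `graft`. -/
def graftParent {T : RootedTree.{0}} {M : Set T} {k : ℕ} : T ⊕ (M × Fin k) → T ⊕ (M × Fin k) :=
  Sum.elim (fun v => Sum.inl (Order.pred v)) (fun x => Sum.inl x.1)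

theorem exists_iterate_graftParent {T : RootedTree.{0}} {M : Set T} {k : ℕ}
    (x : T ⊕ (M × Fin k)) : ∃ i, graftParent^[i] x = Sum.inl ⊥ := by
  have h1 : ∀ v : T, ∃ i, graftParent^[i] (Sum.inl v : T ⊕ (M × Fin k)) = Sum.inl ⊥ := by
    intro v
    obtain ⟨i, hi⟩ := (bot_le (a := v)).exists_pred_iterate
    refine ⟨i, ?_⟩
    rw [← hi]
    exact ((Function.Semiconj.iterate_right (f := Sum.inl) (ga := Order.pred)
      (gb := (graftParent : T ⊕ (M × Fin k) → _)) (fun _ => rfl) i) v).symm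
  rcases x with v | x
  · exact h1 v
  · obtain ⟨i, hi⟩ := h1 x.1
    exact ⟨i + 1, hi⟩

/-- The tree obtained from `T` by adding `k` children, which are leaves, to each node of `M`. -/
noncomputable def graft (T : RootedTree.{0}) (M : Set T) (k : ℕ) : RootedTree.{0} :=
  parentTree (Sum.inl ⊥ : T ⊕ (M × Fin k)) graftParent
    (congrArg Sum.inl (Order.pred_bot)) exists_iterate_graftParent

variable {T : RootedTree.{0}} {M : Set T} {k : ℕ}

/-- The nodes of `graft T M k` in terms of those of `T` and of the added leaves. -/
noncomputable def graftEquiv : T ⊕ (M × Fin k) ≃ graft T M k :=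
  Equiv.ofBijective (toParentTree _ _) toParentTree_bijective

instance [Finite T] : Finite (graft T M k) := Finite.of_equiv _ graftEquiv

theorem card_graft [Finite T] : Nat.card (graft T M k) = Nat.card T + M.ncard * k := by
  rw [← Nat.card_congr graftEquiv, Nat.card_sum, Nat.card_prod, Nat.card_fin,
    Nat.card_coe_set_eq]

/-- The inclusion of `T` in `graft T M k`. -/
noncomputable def graftInl (v : T) : graft T M k := graftEquiv (Sum.inl v)

/-- The added leaves of `graft T M k`. -/
noncomputable def graftInr (x : M × Fin k) : graft T M k := graftEquiv (Sum.inr x)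

theorem graftInr_injective : Function.Injective (graftInr : M × Fin k → graft T M k) :=
  graftEquiv.injective.comp Sum.inr_injective

theorem preservesNca_graftInl : PreservesNca (graftInl : T → graft T M k) :=
  preservesNca_of_pred (graftEquiv.injective.comp Sum.inl_injective) fun _ => rfl

theorem graftInl_covBy_graftInr (x : M × Fin k) : graftInl (x.1 : T) ⋖ graftInr x :=
  toParentTree_covBy.2 ⟨Sum.inr_ne_inl, rfl⟩

theorem deg_graftEquiv (x : T ⊕ (M × Fin k)) :
    deg (graft T M k) (graftEquiv x) = {y | y ≠ Sum.inl ⊥ ∧ graftParent y = x}.ncard :=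
  deg_toParentTree x

theorem deg_graftInr (x : M × Fin k) : deg (graft T M k) (graftInr x) = 0 := by
  rw [graftInr, deg_graftEquiv, ← Set.ncard_empty (T ⊕ (M × Fin k))]
  congr 1
  ext y
  rcases y with y | y <;> simp [graftParent]

theorem deg_graftInl_of_notMem {v : T} (hv : v ∉ M) :
    deg (graft T M k) (graftInl v) = deg T v := by
  rw [graftInl, deg_graftEquiv, deg, ← Set.ncard_image_of_injective _
    (Sum.inl_injective : Function.Injective (Sum.inl : T → T ⊕ (M × Fin k)))]
  congr 1
  ext y
  rcases y with y | ⟨⟨y, hy⟩, i⟩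
  · simp [graftParent, covBy_iff_pred]
  · have : y ≠ v := fun h => hv (h ▸ hy)
    simpa [graftParent] using this

theorem deg_graftInl_of_mem [Finite T] {v : T} (hv : v ∈ M) (h0 : deg T v = 0) :
    deg (graft T M k) (graftInl v) = k := by
  rw [graftInl, deg_graftEquiv]
  have hinj : Function.Injective fun i : Fin k => (Sum.inr (⟨v, hv⟩, i) : T ⊕ (M × Fin k)) :=
    fun i j hij => by simpa using hij
  trans (Set.univ : Set (Fin k)).ncard
  swap
  · rw [Set.ncard_univ, Nat.card_fin]
  rw [← Set.ncard_image_of_injective _ hinj]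
  congr 1
  ext y
  rcases y with y | ⟨⟨y, hy⟩, i⟩
  · have := deg_eq_zero_iff.1 h0 y
    simpa [graftParent, covBy_iff_pred] using this
  · simp [graftParent, eq_comm]

theorem numLeaves_graft [Finite T] (hM : ∀ v ∈ M, deg T v = 0) (hk : 0 < k) :
    numLeaves (graft T M k) + M.ncard = numLeaves T + M.ncard * k := by
  have e : {v : graft T M k | deg _ v = 0} =
      graftInl '' ({v : T | deg T v = 0} \ M) ∪ Set.range graftInr := by
    ext w
    obtain ⟨y | y, rfl⟩ := graftEquiv.surjective w
    · change deg _ (graftInl y) = 0 ↔ graftInl y ∈ _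
      have hr : graftInl y ∉ Set.range (graftInr : M × Fin k → graft T M k) := by
        rintro ⟨z, hz⟩
        exact Sum.inr_ne_inl (graftEquiv.injective hz)
      rw [Set.mem_union, or_iff_left hr, preservesNca_graftInl.1.mem_set_image]
      by_cases hy : y ∈ M
      · rw [deg_graftInl_of_mem hy (hM y hy)]
        simp [hy, hk.ne']
      · rw [deg_graftInl_of_notMem hy]
        simp [hy]
    · exact iff_of_true (deg_graftInr y) (Or.inr ⟨y, rfl⟩)
  have hd : Disjoint (graftInl '' ({v : T | deg T v = 0} \ M))
      (Set.range (graftInr : M × Fin k → graft T M k)) := by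
    rw [Set.disjoint_left]
    rintro _ ⟨v, -, rfl⟩ ⟨z, hz⟩
    exact Sum.inr_ne_inl (graftEquiv.injective hz)
  rw [numLeaves, e, Set.ncard_union_eq hd (Set.toFinite _) (Set.toFinite _),
    Set.ncard_image_of_injective _ preservesNca_graftInl.1, ← Set.image_univ,
    Set.ncard_image_of_injective _ graftInr_injective, Set.ncard_univ, Nat.card_prod,
    Nat.card_fin, Nat.card_coe_set_eq, numLeaves]
  have := Set.ncard_sdiff_add_ncard_of_subset (s := M) (t := {v : T | deg T v = 0}) hM
    (Set.toFinite _)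
  omega

theorem deg_graft_ne_one [Finite T] (hT : ∀ v : T, deg T v ≠ 1) (hM : ∀ v ∈ M, deg T v = 0)
    (hk : k ≠ 1) (w : graft T M k) : deg _ w ≠ 1 := by
  obtain ⟨y | y, rfl⟩ := graftEquiv.surjective w
  · change deg _ (graftInl y) ≠ 1
    by_cases hy : y ∈ M
    · rwa [deg_graftInl_of_mem hy (hM y hy)]
    · rw [deg_graftInl_of_notMem hy]
      exact hT y
  · change deg _ (graftInr y) ≠ 1
    rw [deg_graftInr]
    exact zero_ne_one

theorem containsSubdivision_graft : ContainsSubdivision (graft T M k) T :=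
  containsSubdivision_iff.2 ⟨_, preservesNca_graftInl⟩

end Graft

/-! ### Existence of universal trees -/

section Existence

/-- The parent functions of trees on `Fin N`. -/
def ParentFun (N : ℕ) : Type :=
  {p : Fin N → Fin N // ∃ r, p r = r ∧ ∀ x, ∃ k, p^[k] x = r}

instance (N : ℕ) : Finite (ParentFun N) := inferInstanceAs (Finite (Subtype _))

/-- The parent function of `allTrees`. -/
noncomputable def allTreesParent (N : ℕ) :
    Option (ParentFun N × Fin N) → Option (ParentFun N × Fin N)
  | none => none
  -- The only fixed point of such a parent function is its root, so exactly the roots are attached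
  -- to `none`.
  | some (p, x) => by classical exact if p.1 x = x then none else some (p, p.1 x)

theorem exists_iterate_allTreesParent {N : ℕ} (x : Option (ParentFun N × Fin N)) :
    ∃ k, (allTreesParent N)^[k] x = none := by
  rcases x with _ | ⟨⟨p, r, hr, h⟩, x⟩
  · exact ⟨0, rfl⟩
  · obtain ⟨k, hk⟩ := h x
    induction k generalizing x with
    | zero =>
      refine ⟨1, ?_⟩
      have hx : x = r := hk
      simp [allTreesParent, hx, hr]
    | succ k ih =>
      by_cases hx : p x = x
      · exact ⟨1, by simp [allTreesParent, hx]⟩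
      · obtain ⟨i, hi⟩ := ih (p x) hk
        exact ⟨i + 1, by simpa [allTreesParent, hx] using hi⟩

/-- The tree whose root has all trees on `N` nodes below it. -/
noncomputable def allTrees (N : ℕ) : RootedTree.{0} :=
  parentTree none (allTreesParent N) rfl exists_iterate_allTreesParent

instance (N : ℕ) : Finite (allTrees N) :=
  inferInstanceAs (Finite (Option (ParentFun N × Fin N)))

theorem isMinorUniversal_allTrees (N : ℕ) : IsMinorUniversal (allTrees N) N := by
  intro T _ hT
  let e : T ≃ Fin N := (Finite.equivFin T).trans (finCongr hT)
  have hit : ∀ k v, (fun x => e (Order.pred (e.symm x)))^[k] (e v) = e (Order.pred^[k] v) :=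
    fun k v => ((Function.Semiconj.iterate_right (f := e) (ga := Order.pred)
      (gb := fun x => e (Order.pred (e.symm x))) (fun _ => by simp) k) v).symm
  let p : ParentFun N := ⟨fun x => e (Order.pred (e.symm x)), e ⊥, by simp, fun x => by
    obtain ⟨k, hk⟩ := (bot_le (a := e.symm x)).exists_pred_iterate
    refine ⟨k, ?_⟩
    rw [← hk, ← hit, e.apply_symm_apply]⟩
  refine containsSubdivision_of_covBy
    (f := fun v => toParentTree rfl exists_iterate_allTreesParent (some (p, e v))) ?_ ?_
  · intro a b hab
    simpa using toParentTree_bijective.1 hab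
  · intro a b hab
    refine toParentTree_covBy.2 ⟨Option.some_ne_none _, ?_⟩
    have hb := hab.pred_eq
    have hne : a ≠ b := hab.ne
    simp [allTreesParent, p, hb, hne]

/-- Extra leaves below the root pad `T` to exactly `N` nodes. -/
theorem IsMinorUniversal.mono {U : RootedTree.{0}} {N : ℕ} (hU : IsMinorUniversal U N)
    {T : RootedTree.{0}} [Finite T] (hT : Nat.card T ≤ N) : ContainsSubdivision U T := by
  refine (hU (graft T {⊥} (N - Nat.card T)) inferInstance ?_).trans containsSubdivision_graft
  rw [card_graft, Set.ncard_singleton]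
  omega

theorem IsMinorUniversal.isLeafUniversal {U : RootedTree.{0}} {N n : ℕ}
    (hU : IsMinorUniversal U N) (hn : 2 * n ≤ N + 1) : IsLeafUniversal U n := by
  intro T _ hT h1
  have := card_lt_two_mul_numLeaves h1
  exact hU.mono (by omega)

theorem u_le_numLeaves {U : RootedTree.{0}} [Finite U] {n : ℕ} (hU : IsLeafUniversal U n) :
    u n ≤ numLeaves U :=
  Nat.sInf_le ⟨U, inferInstance, hU, rfl⟩

/-- The infimum is attained because a universal tree exists; over an empty set `sInf` would be 0. -/
theorem exists_numLeaves_eq_u (n : ℕ) :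
    ∃ U : RootedTree.{0}, Finite U ∧ IsLeafUniversal U n ∧ numLeaves U = u n :=
  Nat.sInf_mem (s := {k : ℕ | ∃ U : RootedTree.{0}, Finite U ∧ IsLeafUniversal U n ∧
    numLeaves U = k}) ⟨_, allTrees (2 * n), inferInstance,
      (isMinorUniversal_allTrees _).isLeafUniversal (by omega), rfl⟩

theorem exists_card_eq_minorUniversalSize (N : ℕ) :
    ∃ U : RootedTree.{0}, Finite U ∧ IsMinorUniversal U N ∧ Nat.card U = minorUniversalSize N :=
  Nat.sInf_mem (s := {k : ℕ | ∃ U : RootedTree.{0}, Finite U ∧ IsMinorUniversal U N ∧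
    Nat.card U = k}) ⟨_, allTrees N, inferInstance, isMinorUniversal_allTrees _, rfl⟩

theorem one_le_u (n : ℕ) : 1 ≤ u n := by
  obtain ⟨U, _, -, hU⟩ := exists_numLeaves_eq_u n
  exact hU ▸ one_le_numLeaves

theorem u_le_minorUniversalSize {N n : ℕ} (hn : 2 * n ≤ N + 1) : u n ≤ minorUniversalSize N := by
  obtain ⟨U, _, hU, hc⟩ := exists_card_eq_minorUniversalSize N
  exact hc ▸ (u_le_numLeaves (hU.isLeafUniversal hn)).trans numLeaves_le_card

end Existence

/-! ### Chains of nodes of large degree -/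

section Chains

/-- Some downward path starting at `v` has at least `j` nodes of degree at least `d`, each of them
followed by another node of the path. -/
def HasChain (U : RootedTree.{0}) (d : ℕ) : ℕ → U → Prop
  | 0, _ => True
  | j + 1, v => ∃ w, v ≤ w ∧ d ≤ deg U w ∧ ∃ x, w < x ∧ HasChain U d j x

variable {T U : RootedTree.{0}} {n d : ℕ}

theorem HasChain.of_le {j : ℕ} {v w : U} (hw : HasChain U d j w) (hvw : v ≤ w) :
    HasChain U d j v := by
  cases j with
  | zero => trivial
  | succ j =>
    obtain ⟨x, hx, h⟩ := hw
    exact ⟨x, hvw.trans hx, h⟩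

theorem HasChain.anti {i j : ℕ} {v : U} (hv : HasChain U d j v) (hij : i ≤ j) :
    HasChain U d i v := by
  induction hij with
  | refl => exact hv
  | step _ ih =>
    obtain ⟨w, hvw, -, x, hwx, hx⟩ := hv
    exact ih (hx.of_le (hvw.trans hwx.le))

/-- Giving one leaf `n - numLeaves T + 1` children brings the leaf count to exactly `n`. In the
strict case this is at least two children, so no degree-1 node arises. -/
theorem IsLeafUniversal.exists_preservesNca (hU : IsLeafUniversal U n) [Finite T]
    (hT : ∀ v : T, deg T v ≠ 1) (hn : numLeaves T ≤ n) : ∃ f : T → U, PreservesNca f := by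
  rw [← containsSubdivision_iff]
  obtain ⟨l, -, hl⟩ := exists_leaf_ge (⊥ : T)
  have hM : ∀ v ∈ ({l} : Set T), deg T v = 0 := by simpa using hl
  rcases hn.eq_or_lt with h | h
  · exact hU T inferInstance h hT
  · have hc := numLeaves_graft (k := n - numLeaves T + 1) hM (Nat.succ_pos _)
    rw [Set.ncard_singleton] at hc
    exact (hU (graft T {l} (n - numLeaves T + 1)) inferInstance (by omega)
      (deg_graft_ne_one hT hM (by omega))).trans containsSubdivision_graft

/-- The caterpillars are grown level by level: every marked leaf receives `d` leaf children, one of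
which is marked for the next level. A level costs `d - 1` leaves per marked leaf, and the image of
the old leaf has degree at least `d`. -/
theorem IsLeafUniversal.exists_preservesNca_hasChain [Finite U] (hU : IsLeafUniversal U n)
    (hd : 2 ≤ d) (j : ℕ) : ∀ (T : RootedTree.{0}) [Finite T] (M : Set T),
    (∀ v : T, deg T v ≠ 1) → (∀ v ∈ M, deg T v = 0) →
    numLeaves T + M.ncard * (j * (d - 1)) ≤ n →
    ∃ f : T → U, PreservesNca f ∧ ∀ l ∈ M, HasChain U d j (f l) := by
  induction j with
  | zero =>
    intro T _ M hT _ hn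
    obtain ⟨f, hf⟩ := hU.exists_preservesNca hT (by omega)
    exact ⟨f, hf, fun _ _ => trivial⟩
  | succ j ih =>
    intro T _ M hT hM hn
    let i0 : Fin d := ⟨0, by omega⟩
    let g : M → graft T M d := fun l => graftInr (l, i0)
    have hg : Function.Injective g := fun a b hab => by simpa using graftInr_injective hab
    have hcard : (Set.range g).ncard = M.ncard := by
      rw [← Set.image_univ, Set.ncard_image_of_injective _ hg, Set.ncard_univ,
        Nat.card_coe_set_eq]
    obtain ⟨f, hf, hc⟩ := ih (graft T M d) (Set.range g) (deg_graft_ne_one hT hM (by omega))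
      (by rintro _ ⟨l, rfl⟩; exact deg_graftInr _) (by
        rw [hcard]
        have h1 := numLeaves_graft (k := d) hM (by omega)
        obtain ⟨e, rfl⟩ : ∃ e, d = e + 1 := ⟨d - 1, by omega⟩
        simp only [Nat.add_sub_cancel] at hn ⊢
        nlinarith)
    refine ⟨f ∘ graftInl, hf.comp preservesNca_graftInl, fun l hl => ?_⟩
    refine ⟨f (graftInl l), le_rfl, ?_, f (g ⟨l, hl⟩), ?_, hc _ ⟨_, rfl⟩⟩
    · exact (deg_graftInl_of_mem hl (hM l hl)).ge.trans (hf.deg_le _)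
    · exact hf.lt_iff.2 (graftInl_covBy_graftInr (⟨l, hl⟩, i0)).lt

/-- The tree with a single node. -/
noncomputable def singleNode : RootedTree.{0} :=
  parentTree () id rfl fun _ => ⟨0, rfl⟩

instance : Unique singleNode := inferInstanceAs (Unique Unit)

theorem deg_singleNode (v : singleNode) : deg singleNode v = 0 :=
  deg_eq_zero_iff.2 fun w hw => hw.lt.ne (Subsingleton.elim v w)

theorem numLeaves_singleNode : numLeaves singleNode = 1 := by
  simp [numLeaves, deg_singleNode, Set.ncard_univ]

/-- Obtained from a single caterpillar. It ensures that the truncation to chain starts contains the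
root. -/
theorem IsLeafUniversal.hasChain_bot [Finite U] (hU : IsLeafUniversal U n) (hd : 2 ≤ d) {j : ℕ}
    (hj : j * (d - 1) + 1 ≤ n) : HasChain U d j ⊥ := by
  obtain ⟨f, -, hf⟩ := hU.exists_preservesNca_hasChain hd j singleNode {⊥}
    (fun v => by rw [deg_singleNode]; exact zero_ne_one) (fun v _ => deg_singleNode v)
    (by rw [numLeaves_singleNode, Set.ncard_singleton]; omega)
  exact (hf ⊥ rfl).of_le bot_le

end Chains

/-! ### Truncations of trees -/

section Truncation

/-- The subtree of `U` on a non-empty set of nodes that is closed under taking ancestors. -/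
noncomputable def truncation (U : RootedTree.{0}) (P : U → Prop) (hP : ∀ v w, v ≤ w → P w → P v)
    (hbot : P ⊥) : RootedTree.{0} :=
  letI : SemilatticeInf {v : U // P v} :=
    Subtype.semilatticeInf fun _ _ ha _ => hP _ _ inf_le_left ha
  letI : OrderBot {v : U // P v} := { bot := ⟨⊥, hbot⟩, bot_le := fun v => bot_le (a := v.1) }
  letI : PredOrder {v : U // P v} :=
    { pred := fun v => ⟨Order.pred v.1, hP _ _ (Order.pred_le v.1) v.2⟩
      pred_le := fun v => Order.pred_le v.1
      min_of_le_pred := fun {v} hv w _ => by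
        have hm : IsMin v.1 := Order.le_pred_iff_isMin.1 hv
        exact (isMin_iff_eq_bot.1 hm).trans_le (bot_le (a := w.1))
      le_pred_of_lt := fun {v w} h => Order.le_pred_of_lt (show v.1 < w.1 from h) }
  haveI : IsPredArchimedean {v : U // P v} :=
    ⟨fun {v w} h => by
      obtain ⟨k, hk⟩ := IsPredArchimedean.exists_pred_iterate_of_le (show v.1 ≤ w.1 from h)
      refine ⟨k, Subtype.ext (Eq.trans ?_ hk)⟩
      exact (Function.Semiconj.iterate_right (f := Subtype.val) (fun _ => rfl) k) w⟩
  { α := {v : U // P v} }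

variable {T U : RootedTree.{0}} {P : U → Prop} {hP : ∀ v w, v ≤ w → P w → P v} {hbot : P ⊥}

/-- The inclusion of a truncation. -/
def truncationVal (v : truncation U P hP hbot) : U := Subtype.val (p := P) v

theorem truncationVal_injective :
    Function.Injective (truncationVal : truncation U P hP hbot → U) :=
  Subtype.val_injective

theorem truncationVal_prop (v : truncation U P hP hbot) : P (truncationVal v) :=
  Subtype.property (p := P) v

instance [Finite U] : Finite (truncation U P hP hbot) :=
  Finite.of_injective _ truncationVal_injective

theorem containsSubdivision_truncation {f : T → U} (hf : PreservesNca f) (h : ∀ v, P (f v)) :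
    ContainsSubdivision (truncation U P hP hbot) T := by
  refine containsSubdivision_iff.2 ⟨fun v => (⟨f v, h v⟩ : {v : U // P v}), ?_, ?_⟩
  · exact fun a b hab => hf.1 (congrArg truncationVal hab)
  · exact fun a b => truncationVal_injective (hf.2 a b)

theorem numLeaves_truncation_le [Finite U] :
    numLeaves (truncation U P hP hbot) ≤ {v | P v ∧ ∀ w, v ⋖ w → ¬ P w}.ncard := by
  refine Set.ncard_le_ncard_of_injOn truncationVal ?_ truncationVal_injective.injOn
    (Set.toFinite _)
  intro v hv
  refine ⟨truncationVal_prop v, fun w hvw hw => ?_⟩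
  refine deg_eq_zero_iff.1 hv (⟨w, hw⟩ : {v : U // P v}) ⟨hvw.lt, ?_⟩
  exact fun c h1 h2 => hvw.2 (c := truncationVal c) h1 h2

end Truncation

/-! ### Nodes of large degree in leaf-universal trees -/

section Recurrence

variable {U : RootedTree.{0}} {n d : ℕ}

/-- The lowest nodes at which a chain of `j` nodes of degree at least `d` starts. -/
def chainTops (U : RootedTree.{0}) (d j : ℕ) : Set U :=
  {v | HasChain U d j v ∧ ∀ w, v ⋖ w → ¬ HasChain U d j w}

/-- The first chain node must be `v` itself; otherwise the same chain would already start at a child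
of `v`. -/
theorem le_deg_of_mem_chainTops {j : ℕ} (hj : 1 ≤ j) {v : U} (hv : v ∈ chainTops U d j) :
    d ≤ deg U v := by
  obtain ⟨i, rfl⟩ := Nat.exists_eq_add_of_le' hj
  obtain ⟨⟨w, hvw, hw, h⟩, hmax⟩ := hv
  rcases hvw.eq_or_lt with rfl | hlt
  · exact hw
  · obtain ⟨c, hc, hcw⟩ := exists_covBy_le hlt
    exact absurd ⟨w, hcw, hw, h⟩ (hmax c hc)

/-- Dropping the first node of a chain of length `j` from `v` leaves a chain of length `j - 1 ≥ i`
starting at a child of `v`. -/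
theorem disjoint_chainTops {i j : ℕ} (hij : i < j) :
    Disjoint (chainTops U d i) (chainTops U d j) := by
  rw [Set.disjoint_left]
  rintro v hi ⟨hj, -⟩
  obtain ⟨k, rfl⟩ : ∃ k, j = k + 1 := ⟨j - 1, by omega⟩
  obtain ⟨w, hvw, -, x, hwx, hx⟩ := hj
  obtain ⟨c, hc, hcx⟩ := exists_covBy_le (hvw.trans_lt hwx)
  exact hi.2 c hc ((hx.of_le hcx).anti (Nat.lt_succ_iff.1 hij))

/-- The truncation of `U` to the starts of `j`-chains is universal for the smaller leaf number: a
chain is forced below every leaf of `T`, and all other nodes of `T` lie above a leaf. The leaves of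
the truncation are chain tops. -/
theorem IsLeafUniversal.u_le_ncard_chainTops [Finite U] (hU : IsLeafUniversal U n) (hd : 2 ≤ d)
    {j : ℕ} (hj : j * (d - 1) + 1 ≤ n) :
    u (n / (j * (d - 1) + 1)) ≤ (chainTops U d j).ncard := by
  refine le_trans (u_le_numLeaves (U := truncation U (HasChain U d j)
    (fun v w hvw hw => hw.of_le hvw) (hU.hasChain_bot hd hj)) ?_) numLeaves_truncation_le
  intro T _ hT h1
  obtain ⟨f, hf, hc⟩ := hU.exists_preservesNca_hasChain hd j T {v | deg T v = 0} h1
    (fun _ hv => hv) (by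
      change numLeaves T + numLeaves T * (j * (d - 1)) ≤ n
      rw [hT, add_comm, ← Nat.mul_succ]
      exact Nat.div_mul_le_self _ _)
  refine containsSubdivision_truncation hf fun v => ?_
  obtain ⟨l, hvl, hl⟩ := exists_leaf_ge v
  exact (hc l hl).of_le (hf.le_iff.2 hvl)

theorem IsLeafUniversal.sum_u_le_numDegGe [Finite U] (hU : IsLeafUniversal U n) (hd : 2 ≤ d)
    (S : Finset ℕ) (hS : ∀ s ∈ S, 2 ≤ s ∧ (s - 1) * (d - 1) + 1 ≤ n) :
    ∑ s ∈ S, u (n / ((s - 1) * (d - 1) + 1)) ≤ numDegGe U d := by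
  classical
  have := Fintype.ofFinite U
  calc ∑ s ∈ S, u (n / ((s - 1) * (d - 1) + 1))
      ≤ ∑ s ∈ S, (chainTops U d (s - 1)).toFinset.card := by
        refine Finset.sum_le_sum fun s hs => ?_
        rw [← Set.ncard_eq_toFinset_card']
        exact hU.u_le_ncard_chainTops hd (hS s hs).2
    _ = (S.biUnion fun s => (chainTops U d (s - 1)).toFinset).card := by
        refine (Finset.card_biUnion fun s hs t ht hst => ?_).symm
        have h1 := (hS s hs).1
        have h2 := (hS t ht).1
        refine Set.disjoint_toFinset.2 ?_
        rcases Nat.lt_or_gt_of_ne hst with h | h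
        · exact disjoint_chainTops (by omega)
        · exact (disjoint_chainTops (by omega)).symm
    _ ≤ numDegGe U d := by
        rw [numDegGe, ← Set.ncard_coe_finset]
        refine Set.ncard_le_ncard (fun v hv => ?_) (Set.toFinite _)
        simp only [Finset.coe_biUnion, Set.mem_iUnion, Set.coe_toFinset] at hv
        obtain ⟨s, hs, hv⟩ := hv
        have := (hS s hs).1
        exact le_deg_of_mem_chainTops (by omega) hv

theorem one_add_sum_u_le_u (n : ℕ) :
    1 + ∑ p ∈ (Finset.Icc 2 n ×ˢ Finset.Icc 2 n).filter
        (fun p => (p.1 - 1) * (p.2 - 1) + 1 ≤ n),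
      u (n / ((p.1 - 1) * (p.2 - 1) + 1)) ≤ u n := by
  obtain ⟨U, _, hU, hu⟩ := exists_numLeaves_eq_u n
  rw [← hu]
  refine le_trans ?_ (one_add_sum_numDegGe_le_numLeaves n)
  rw [Finset.sum_filter, Finset.sum_product_right]
  gcongr with d hd
  rw [← Finset.sum_filter]
  refine hU.sum_u_le_numDegGe (Finset.mem_Icc.1 hd).1 _ fun s hs => ?_
  rw [Finset.mem_filter, Finset.mem_Icc] at hs
  exact ⟨hs.1.1, hs.2⟩

end Recurrence

/-! ### Asymptotics -/

section Growth

/-- The substitution `s = x + 1`, `d = y + 1` turns `(s-1)(d-1)+1` into `xy+1`; a finite set of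
pairs meets the range conditions once `n` is large. -/
theorem sum_u_le_u (F : Finset (ℕ+ × ℕ+)) :
    ∀ᶠ n : ℕ in atTop, ∑ p ∈ F, u (n / (p.1 * p.2 + 1)) ≤ u n := by
  have h : ∀ᶠ n : ℕ in atTop, ∀ p ∈ F, (p.1 : ℕ) + 1 ≤ n ∧ (p.2 : ℕ) + 1 ≤ n ∧
      (p.1 * p.2 + 1 : ℕ) ≤ n := by
    rw [eventually_all_finset]
    intro p _
    exact (eventually_ge_atTop _).and ((eventually_ge_atTop _).and (eventually_ge_atTop _))
  filter_upwards [h] with n hn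
  have hinj : Function.Injective fun p : ℕ+ × ℕ+ => ((p.1 : ℕ) + 1, (p.2 : ℕ) + 1) := by
    rintro ⟨a, b⟩ ⟨c, d⟩ h
    simpa using h
  refine le_trans ?_ ((Nat.le_add_left _ 1).trans (one_add_sum_u_le_u n))
  calc ∑ p ∈ F, u (n / (p.1 * p.2 + 1))
      = ∑ p ∈ F.image fun p : ℕ+ × ℕ+ => ((p.1 : ℕ) + 1, (p.2 : ℕ) + 1),
          u (n / ((p.1 - 1) * (p.2 - 1) + 1)) := by
        rw [Finset.sum_image hinj.injOn]
        simp
    _ ≤ _ := by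
        refine Finset.sum_le_sum_of_subset fun q hq => ?_
        obtain ⟨p, hp, rfl⟩ := Finset.mem_image.1 hq
        obtain ⟨h1, h2, h3⟩ := hn p hp
        have := p.1.pos
        have := p.2.pos
        simp only [Finset.mem_filter, Finset.mem_product, Finset.mem_Icc, Nat.add_sub_cancel]
        exact ⟨⟨⟨by omega, h1⟩, by omega, h2⟩, h3⟩

theorem tendsto_div_rpow {c : ℝ} (k : ℕ) (hk : 0 < k) :
    Tendsto (fun n : ℕ => (((n / k : ℕ) : ℝ) / n) ^ c) atTop (nhds ((k : ℝ) ^ (-c))) := by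
  have hk' : (0 : ℝ) < k := Nat.cast_pos.2 hk
  have h : Tendsto (fun n : ℕ => (((n / k : ℕ) : ℝ) / n)) atTop (nhds ((k : ℝ)⁻¹)) := by
    have h1 := (tendsto_nat_floor_mul_div_atTop (R := ℝ) (a := (k : ℝ)⁻¹) (by positivity)).comp
      tendsto_natCast_atTop_atTop
    refine h1.congr fun n => ?_
    simp only [Function.comp_apply]
    rw [← Nat.floor_div_eq_div (K := ℝ) n k, div_eq_inv_mul (n : ℝ) (k : ℝ)]
  rw [Real.rpow_neg hk'.le, ← Real.inv_rpow hk'.le]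
  exact h.rpow_const (Or.inl (by positivity))

theorem rpow_isBigO_u {c : ℝ}
    (hc : 1 < ∑' p : ℕ+ × ℕ+, ENNReal.ofReal (((p.1 : ℝ) * (p.2 : ℝ) + 1) ^ (-c))) :
    (fun n : ℕ => (n : ℝ) ^ c) =O[atTop] (fun n : ℕ => (u n : ℝ)) := by
  rcases le_or_gt c 0 with hc0 | hc0
  -- For `c ≤ 0` the bound is trivial since `u n ≥ 1`; the induction below needs `n ^ c` to be
  -- monotone.
  · refine IsBigO.of_bound 1 ?_
    filter_upwards [eventually_ge_atTop 1] with n hn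
    have h1 : (1 : ℝ) ≤ n := by exact_mod_cast hn
    have h2 : (1 : ℝ) ≤ u n := by exact_mod_cast one_le_u n
    rw [one_mul, Real.norm_of_nonneg (by positivity), Real.norm_of_nonneg (by positivity)]
    exact (Real.rpow_le_one_of_one_le_of_nonpos h1 hc0).trans h2
  rw [ENNReal.tsum_eq_iSup_sum, lt_iSup_iff] at hc
  obtain ⟨F, hF⟩ := hc
  rw [← ENNReal.ofReal_sum_of_nonneg (fun p _ => by positivity), ENNReal.one_lt_ofReal] at hF
  have hlim : Tendsto (fun n : ℕ => ∑ p ∈ F, (((n / (p.1 * p.2 + 1) : ℕ) : ℝ) / n) ^ c) atTop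
      (nhds (∑ p ∈ F, ((p.1 : ℝ) * (p.2 : ℝ) + 1) ^ (-c))) := by
    refine tendsto_finsetSum _ fun p _ => ?_
    have := tendsto_div_rpow (c := c) ((p.1 : ℕ) * p.2 + 1) (Nat.succ_pos _)
    push_cast at this
    exact this
  obtain ⟨N, hN⟩ := eventually_atTop.1
    ((hlim.eventually_const_lt hF).and ((sum_u_le_u F).and (eventually_ge_atTop 1)))
  have hN1 : 1 ≤ N := (hN N le_rfl).2.2
  have hN0 : (0 : ℝ) < N := by exact_mod_cast hN1
  -- The constant `N ^ c` covers all `n ≤ N` because `u n ≥ 1`. Beyond `N` the recurrence applies,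
  -- and `n / (xy+1) < n` since `xy+1 ≥ 2`.
  have key : ∀ n : ℕ, (n : ℝ) ^ c ≤ (N : ℝ) ^ c * u n := by
    intro n
    induction n using Nat.strong_induction_on with
    | _ n ih =>
      rcases le_total n N with hn | hn
      · have h2 : (1 : ℝ) ≤ u n := by exact_mod_cast one_le_u n
        calc (n : ℝ) ^ c ≤ (N : ℝ) ^ c := by gcongr
          _ ≤ (N : ℝ) ^ c * u n := le_mul_of_one_le_right (by positivity) h2
      · obtain ⟨h1, h2, h3⟩ := hN n hn
        have hn0 : (0 : ℝ) < n := by exact_mod_cast h3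
        calc (n : ℝ) ^ c
            ≤ (∑ p ∈ F, (((n / (p.1 * p.2 + 1) : ℕ) : ℝ) / n) ^ c) * (n : ℝ) ^ c :=
              le_mul_of_one_le_left (by positivity) h1.le
          _ = ∑ p ∈ F, ((n / (p.1 * p.2 + 1) : ℕ) : ℝ) ^ c := by
              rw [Finset.sum_mul]
              refine Finset.sum_congr rfl fun p _ => ?_
              rw [Real.div_rpow (by positivity) hn0.le, div_mul_cancel₀ _ (by positivity)]
          _ ≤ ∑ p ∈ F, (N : ℝ) ^ c * u (n / (p.1 * p.2 + 1)) := by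
              refine Finset.sum_le_sum fun p _ => ih _ (Nat.div_lt_self h3 ?_)
              have := Nat.mul_pos p.1.pos p.2.pos
              omega
          _ = (N : ℝ) ^ c * (∑ p ∈ F, u (n / (p.1 * p.2 + 1)) : ℕ) := by
              rw [← Finset.mul_sum]
              push_cast
              rfl
          _ ≤ (N : ℝ) ^ c * u n := by gcongr
  refine IsBigO.of_bound ((N : ℝ) ^ c) (Eventually.of_forall fun n => ?_)
  rw [Real.norm_of_nonneg (by positivity), Real.norm_of_nonneg (by positivity)]
  exact key n

/-- A minor-universal tree for `N` nodes is leaf-universal for `(N+1)/2` leaves; halving the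
argument costs only the factor `2 ^ c`. -/
theorem rpow_isBigO_minorUniversalSize {c : ℝ} (hc : 0 ≤ c)
    (h : (fun n : ℕ => (n : ℝ) ^ c) =O[atTop] (fun n : ℕ => (u n : ℝ))) :
    (fun N : ℕ => (N : ℝ) ^ c) =O[atTop] (fun N : ℕ => (minorUniversalSize N : ℝ)) := by
  have ht : Tendsto (fun N : ℕ => (N + 1) / 2) atTop atTop :=
    (Nat.tendsto_div_const_atTop two_ne_zero).comp (tendsto_add_atTop_nat 1)
  have h1 : (fun N : ℕ => (N : ℝ) ^ c) =O[atTop] (fun N : ℕ => (((N + 1) / 2 : ℕ) : ℝ) ^ c) := by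
    refine IsBigO.of_bound (2 ^ c) (Eventually.of_forall fun N => ?_)
    rw [Real.norm_of_nonneg (by positivity), Real.norm_of_nonneg (by positivity),
      ← Real.mul_rpow (by positivity) (by positivity)]
    refine Real.rpow_le_rpow (by positivity) ?_ hc
    have : N ≤ 2 * ((N + 1) / 2) := by omega
    exact_mod_cast this
  refine (h1.trans (h.comp_tendsto ht)).trans (IsBigO.of_bound 1 (Eventually.of_forall fun N => ?_))
  rw [one_mul, Function.comp_apply, Real.norm_of_nonneg (by positivity),
    Real.norm_of_nonneg (by positivity)]
  exact_mod_cast u_le_minorUniversalSize (by omega)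

end Growth

/-! ### A numerical lower bound for the double sum -/

section Numeric

/-- The trapezoidal rule overestimates the integral of the convex function `t ^ (-c)`. -/
theorem rpow_sub_rpow_le_trapezoid {c t x : ℝ} (hc : 1 ≤ c) (ht : 0 < t) (hx : 0 ≤ x) :
    t ^ (1 - c) - (t + x) ^ (1 - c) ≤ (c - 1) * x * ((t ^ (-c) + (t + x) ^ (-c)) / 2) := by
  -- The claim is `φ 0 ≤ φ x`.
  let φ : ℝ → ℝ := fun x => (c - 1) * x * ((t ^ (-c) + (t + x) ^ (-c)) / 2) + (t + x) ^ (1 - c)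
  have hd : ∀ y, 0 ≤ y → HasDerivAt φ ((c - 1) / 2 *
      (t ^ (-c) - (t + y) ^ (-c) - c * y * (t + y) ^ (-c - 1))) y := by
    intro y hy
    have hty : t + y ≠ 0 := by positivity
    have h0 : HasDerivAt (fun x => t + x) 1 y := (hasDerivAt_id y).const_add t
    have h1 := h0.rpow_const (p := -c) (Or.inl hty)
    have h2 := h0.rpow_const (p := 1 - c) (Or.inl hty)
    have h3 := (((hasDerivAt_id y).const_mul (c - 1)).mul
      ((h1.const_add (t ^ (-c))).div_const 2)).add h2
    refine h3.congr_deriv ?_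
    rw [show 1 - c - 1 = -c by ring]
    simp only [id]
    ring
  -- The convex function `s ^ (-c)` lies above its tangent at `t + y`, here evaluated at `t`.
  -- Cleared of negative powers this is Bernoulli's inequality with exponent `c + 1`.
  have hnn : ∀ y, 0 ≤ y → 0 ≤ t ^ (-c) - (t + y) ^ (-c) - c * y * (t + y) ^ (-c - 1) := by
    intro y hy
    have hty : 0 < t + y := by positivity
    have hb := one_add_mul_self_le_rpow_one_add (s := y / t) (p := c + 1)
      (by linarith [div_nonneg hy ht.le]) (by linarith)
    have e1 : 1 + y / t = (t + y) / t := by field_simp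
    rw [e1, Real.div_rpow hty.le ht.le, le_div_iff₀ (by positivity), Real.rpow_add_one ht.ne'] at hb
    have e2 : (t + y) ^ (-c) = (t + y) ^ (-c - 1) * (t + y) := by
      rw [← Real.rpow_add_one hty.ne']
      ring_nf
    have e3 : t ^ c * t ^ (-c) = 1 := by
      rw [← Real.rpow_add ht]
      simp
    have e4 : (t + y) ^ (c + 1) * (t + y) ^ (-c - 1) = 1 := by
      rw [← Real.rpow_add hty]
      simp
    have h5 : (t + y + c * y) * t ^ c ≤ (t + y) ^ (c + 1) := by
      refine le_trans (le_of_eq ?_) hb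
      field_simp
      ring
    have h6 := mul_le_mul_of_nonneg_right h5
      (show 0 ≤ t ^ (-c) * (t + y) ^ (-c - 1) by positivity)
    have h7 : (t + y + c * y) * t ^ c * (t ^ (-c) * (t + y) ^ (-c - 1)) =
        (t + y + c * y) * (t + y) ^ (-c - 1) := by
      linear_combination (t + y + c * y) * (t + y) ^ (-c - 1) * e3
    have h8 : (t + y) ^ (c + 1) * (t ^ (-c) * (t + y) ^ (-c - 1)) = t ^ (-c) := by
      linear_combination t ^ (-c) * e4
    rw [h7, h8] at h6
    rw [e2]
    linarith
  have hmono : MonotoneOn φ (Set.Ici 0) := by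
    refine monotoneOn_of_deriv_nonneg (convex_Ici 0)
      (fun y hy => (hd y hy).continuousAt.continuousWithinAt)
      (fun y hy => (hd y (interior_subset hy)).differentiableAt.differentiableWithinAt) ?_
    intro y hy
    rw [(hd y (interior_subset hy)).deriv]
    exact mul_nonneg (by linarith) (hnn y (interior_subset hy))
  have h := hmono Set.self_mem_Ici hx hx
  simp only [φ, mul_zero, zero_mul, add_zero, zero_add] at h
  linarith

/-- A lower bound for the tail `∑ k, (x * (y + k) + 1) ^ (-c)` from the trapezoidal rule. -/
noncomputable def tailBound (c x y : ℝ) : ℝ :=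
  (x * y + 1) ^ (-c) / 2 + (x * y + 1) ^ (1 - c) / (x * (c - 1))

variable {c x y : ℝ}

theorem tailBound_sub_le (hc : 1 < c) (hx : 0 < x) (hy : 0 ≤ y) :
    tailBound c x y - tailBound c x (y + 1) ≤ (x * y + 1) ^ (-c) := by
  have h := rpow_sub_rpow_le_trapezoid (t := x * y + 1) hc.le (by positivity) hx.le
  have hc' : 0 < c - 1 := by linarith
  have e : x * (y + 1) + 1 = x * y + 1 + x := by ring
  rw [tailBound, tailBound, e]
  have h2 : ((x * y + 1) ^ (1 - c) - (x * y + 1 + x) ^ (1 - c)) / (x * (c - 1)) ≤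
      ((x * y + 1) ^ (-c) + (x * y + 1 + x) ^ (-c)) / 2 := by
    rw [div_le_iff₀ (by positivity)]
    linarith
  rw [sub_div] at h2
  linarith

theorem tendsto_tailBound (hc : 1 < c) (hx : 0 < x) :
    Tendsto (fun k : ℕ => tailBound c x (y + k)) atTop (nhds 0) := by
  have h : Tendsto (fun k : ℕ => x * (y + k) + 1) atTop atTop :=
    tendsto_atTop_add_const_right _ _
      ((tendsto_atTop_add_const_left _ _ tendsto_natCast_atTop_atTop).const_mul_atTop hx)
  have h1 := (tendsto_rpow_neg_atTop (y := c) (by linarith)).comp h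
  have h2 := (tendsto_rpow_neg_atTop (y := c - 1) (by linarith)).comp h
  have h3 := (h1.div_const 2).add (h2.div_const (x * (c - 1)))
  simp only [zero_div, add_zero, neg_sub] at h3
  exact h3

/-- Each term dominates a difference of consecutive values of `tailBound`; the sum telescopes and
`tailBound` tends to 0. -/
theorem ofReal_tailBound_le (hc : 1 < c) (hx : 0 < x) (hy : 0 ≤ y) :
    ENNReal.ofReal (tailBound c x y) ≤
      ∑' k : ℕ, ENNReal.ofReal ((x * (y + k) + 1) ^ (-c)) := by
  have hlim : Tendsto (fun k : ℕ => ENNReal.ofReal (tailBound c x y - tailBound c x (y + k)))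
      atTop (nhds (ENNReal.ofReal (tailBound c x y))) := by
    refine ENNReal.tendsto_ofReal ?_
    simpa using (tendsto_tailBound (y := y) hc hx).const_sub (tailBound c x y)
  refine le_of_tendsto' hlim fun n => le_trans ?_ (ENNReal.sum_le_tsum (Finset.range n))
  rw [← ENNReal.ofReal_sum_of_nonneg (fun k _ => by positivity)]
  refine ENNReal.ofReal_le_ofReal ?_
  induction n with
  | zero => simp
  | succ n ih =>
    rw [Finset.sum_range_succ]
    have := tailBound_sub_le hc hx (add_nonneg hy n.cast_nonneg)
    push_cast
    rw [← add_assoc]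
    linarith

theorem ofReal_sum_add_tailBound_le (hc : 1 < c) (hx : 0 < x) (hy : 0 ≤ y) (K : ℕ) :
    ENNReal.ofReal (∑ k ∈ Finset.range K, (x * (y + k) + 1) ^ (-c) + tailBound c x (y + K)) ≤
      ∑' k : ℕ, ENNReal.ofReal ((x * (y + k) + 1) ^ (-c)) := by
  rw [← Summable.sum_add_tsum_nat_add' (k := K) ENNReal.summable]
  refine ENNReal.ofReal_add_le.trans (add_le_add ?_ ?_)
  · exact (ENNReal.ofReal_sum_of_nonneg fun k _ => by positivity).le
  · refine (ofReal_tailBound_le hc hx (by positivity)).trans (le_of_eq (tsum_congr fun k => ?_))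
    push_cast
    ring_nf

/-- A symmetric double sum, split along the diagonal. -/
theorem sum_rows_le_tsum (a : ℕ → ℕ → ENNReal) (ha : ∀ x y, a x y = a y x) (X : ℕ) :
    ∑ x ∈ Finset.range X, (∑' k, a x (x + k) + ∑' k, a x (x + 1 + k)) ≤ ∑' x, ∑' y, a x y := by
  refine (ENNReal.sum_le_tsum _).trans ?_
  rw [ENNReal.tsum_add, ← ENNReal.tsum_prod, ← ENNReal.tsum_prod, ← ENNReal.tsum_prod]
  -- The left summand covers the pairs on or above the diagonal, the right one those strictly below
  -- it, which symmetry exchanges with pairs strictly above.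
  let g : ℕ × ℕ ⊕ ℕ × ℕ → ℕ × ℕ :=
    Sum.elim (fun p => (p.1, p.1 + p.2)) (fun p => (p.1 + 1 + p.2, p.1))
  have hg : Function.Injective g := by
    rintro (⟨i, j⟩ | ⟨i, j⟩) (⟨k, l⟩ | ⟨k, l⟩) h <;>
      simp only [g, Sum.elim_inl, Sum.elim_inr, Prod.mk.injEq] at h <;>
      simp <;> omega
  refine le_trans (le_of_eq ?_)
    (ENNReal.tsum_comp_le_tsum_of_injective hg fun p : ℕ × ℕ => a p.1 p.2)
  rw [Summable.tsum_sum ENNReal.summable ENNReal.summable]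
  congr 1
  exact tsum_congr fun p => ha _ _

/-- Adds the bits of `q`, from `2 ^ (b - 1)` down, that keep `q ^ 500` at most `A`. -/
def rootAux (A : ℕ) : ℕ → ℕ → ℕ
  | 0, q => q
  | b + 1, q => bif Nat.ble ((q + 2 ^ b) ^ 500) A then rootAux A b (q + 2 ^ b) else rootAux A b q

set_option exponentiation.threshold 500 in
theorem rootAux_pow_le {A : ℕ} (b : ℕ) : ∀ q, q ^ 500 ≤ A → rootAux A b q ^ 500 ≤ A := by
  induction b with
  | zero => exact fun q hq => hq
  | succ b ih =>
    intro q hq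
    rw [rootAux]
    cases h : Nat.ble ((q + 2 ^ b) ^ 500) A
    · exact ih q hq
    · exact ih _ (Nat.le_of_ble_eq_true h)

/-- An integer slightly below `2 ^ 30 * t ^ (-2.174)`. -/
def lowPow (t : ℕ) : ℕ := rootAux (2 ^ 15000 / t ^ 1087) 28 0

set_option exponentiation.threshold 15000 in
-- As `2.174 = 1087/500`, the 500th power of the claim is an inequality of integers. The 28 bits
-- lose nothing for `t ≥ 2`, where `2 ^ 30 * t ^ (-2.174) < 2 ^ 28`.
theorem lowPow_le {t : ℕ} (ht : 0 < t) : (lowPow t : ℝ) ≤ 2 ^ 30 * (t : ℝ) ^ (-(2.174 : ℝ)) := by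
  have ht' : (0 : ℝ) < t := Nat.cast_pos.2 ht
  have h1 : lowPow t ^ 500 * t ^ 1087 ≤ 2 ^ 15000 :=
    (Nat.le_div_iff_mul_le (by positivity)).1 (rootAux_pow_le 28 0 (by simp))
  have h2 : (lowPow t : ℝ) ^ 500 * (t : ℝ) ^ 1087 ≤ (2 ^ 30) ^ 500 := by
    rw [← pow_mul]
    exact_mod_cast h1
  refine le_of_pow_le_pow_left₀ (n := 500) (by norm_num) (by positivity) ?_
  have e : ((t : ℝ) ^ (-(2.174 : ℝ))) ^ 500 = ((t : ℝ) ^ 1087)⁻¹ := by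
    rw [← Real.rpow_natCast, ← Real.rpow_mul ht'.le, ← Real.rpow_natCast, ← Real.rpow_neg ht'.le]
    norm_num
  rw [mul_pow, e, ← div_eq_mul_inv, le_div_iff₀ (by positivity)]
  exact h2

/-- An integer below `2 ^ 30 * tailBound 2.174 x y`. -/
def lowTail (x y : ℕ) : ℕ := lowPow (x * y + 1) * (587 * x + 1000 * (x * y + 1)) / (1174 * x)

/-- With `t = xy+1` and `c - 1 = 587/500`, `tailBound` equals `t ^ (-c) * (587x + 1000t) / (1174x)`.
-/
theorem lowTail_le {x : ℕ} (hx : 0 < x) (y : ℕ) :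
    (lowTail x y : ℝ) ≤ 2 ^ 30 * tailBound 2.174 x y := by
  have hx' : (0 : ℝ) < x := Nat.cast_pos.2 hx
  have h := lowPow_le (t := x * y + 1) (Nat.succ_pos _)
  have ht : (0 : ℝ) < x * y + 1 := by positivity
  push_cast at h
  refine Nat.cast_div_le.trans ?_
  have e : ((x : ℝ) * y + 1) ^ (1 - (2.174 : ℝ)) =
      (x * y + 1) ^ (-(2.174 : ℝ)) * (x * y + 1) := by
    rw [← Real.rpow_add_one ht.ne']
    norm_num
  rw [tailBound, e]
  push_cast
  rw [div_le_iff₀ (by positivity)]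
  calc _ ≤ 2 ^ 30 * ((x : ℝ) * y + 1) ^ (-(2.174 : ℝ)) * (587 * x + 1000 * (x * y + 1)) := by
        gcongr
    _ = _ := by
        field_simp
        ring

/-- An integer below `2 ^ 30 * ∑' k, (x * (y + k) + 1) ^ (-2.174)`. -/
def lowRow (x y K : ℕ) : ℕ :=
  ∑ k ∈ Finset.range K, lowPow (x * (y + k) + 1) + lowTail x (y + K)

theorem lowRow_le {x : ℕ} (hx : 0 < x) (y K : ℕ) :
    ENNReal.ofReal (lowRow x y K / 2 ^ 30) ≤
      ∑' k : ℕ, ENNReal.ofReal (((x : ℝ) * (y + k : ℕ) + 1) ^ (-(2.174 : ℝ))) := by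
  have hx' : (0 : ℝ) < x := Nat.cast_pos.2 hx
  have h := ofReal_sum_add_tailBound_le (c := 2.174) (x := x) (y := y) (by norm_num) hx'
    y.cast_nonneg K
  push_cast
  refine (ENNReal.ofReal_le_ofReal ?_).trans h
  rw [div_le_iff₀ (by positivity), lowRow]
  push_cast
  rw [add_mul, Finset.sum_mul]
  refine add_le_add (Finset.sum_le_sum fun k _ => ?_) ?_
  · have := lowPow_le (t := x * (y + k) + 1) (Nat.succ_pos _)
    push_cast at this
    linarith
  · have := lowTail_le hx (y + K)
    push_cast at this
    linarith

/-- Row `x + 1` contributes once from the diagonal on and once strictly beyond it. The slowly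
decaying early rows get more explicit terms; `12 - x` is truncated, so from `x = 12` on only the
tail bound is used. -/
theorem two_pow_lt_sum_lowRow :
    2 ^ 30 < ∑ x ∈ Finset.range 40,
      (lowRow (x + 1) (x + 1) (12 - x) + lowRow (x + 1) (x + 2) (12 - x)) := by
  decide +kernel

theorem one_lt_tsum_rpow :
    1 < ∑' p : ℕ+ × ℕ+, ENNReal.ofReal (((p.1 : ℝ) * (p.2 : ℝ) + 1) ^ (-(2.174 : ℝ))) := by
  let a : ℕ → ℕ → ENNReal := fun x y =>
    ENNReal.ofReal ((((x + 1 : ℕ) : ℝ) * ((y + 1 : ℕ) : ℝ) + 1) ^ (-(2.174 : ℝ)))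
  have e : ∑' p : ℕ+ × ℕ+, ENNReal.ofReal (((p.1 : ℝ) * (p.2 : ℝ) + 1) ^ (-(2.174 : ℝ))) =
      ∑' x, ∑' y, a x y := by
    rw [ENNReal.tsum_prod (f := fun x y : ℕ+ =>
      ENNReal.ofReal (((x : ℝ) * (y : ℝ) + 1) ^ (-(2.174 : ℝ))))]
    rw [tsum_pnat_eq_tsum_succ (f := fun x => ∑' y : ℕ+,
      ENNReal.ofReal (((x : ℝ) * (y : ℝ) + 1) ^ (-(2.174 : ℝ))))]
    exact tsum_congr fun x => tsum_pnat_eq_tsum_succ (f := fun y =>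
      ENNReal.ofReal ((((x + 1 : ℕ) : ℝ) * (y : ℝ) + 1) ^ (-(2.174 : ℝ))))
  rw [e]
  refine lt_of_lt_of_le ?_ (sum_rows_le_tsum a (fun x y => by simp only [a, mul_comm]) 40)
  have h1 : (1 : ENNReal) < ENNReal.ofReal (∑ x ∈ Finset.range 40,
      ((lowRow (x + 1) (x + 1) (12 - x) : ℝ) / 2 ^ 30 +
        (lowRow (x + 1) (x + 2) (12 - x) : ℝ) / 2 ^ 30)) := by
    rw [ENNReal.one_lt_ofReal]
    have h := two_pow_lt_sum_lowRow
    simp only [← add_div]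
    rw [← Finset.sum_div, one_lt_div (by positivity)]
    exact_mod_cast h
  refine h1.trans_le ?_
  rw [ENNReal.ofReal_sum_of_nonneg (fun _ _ => by positivity)]
  refine Finset.sum_le_sum fun x _ => ENNReal.ofReal_add_le.trans (add_le_add ?_ ?_)
  · refine (lowRow_le (Nat.succ_pos x) (x + 1) (12 - x)).trans (le_of_eq (tsum_congr fun k => ?_))
    simp only [a, add_right_comm]
  · refine (lowRow_le (Nat.succ_pos x) (x + 2) (12 - x)).trans (le_of_eq (tsum_congr fun k => ?_))
    simp only [a]
    congr 5
    omega

end Numeric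

/-- The filters encode the convention `u(0) = 0`: the set defining `u 0` yields a value of at least
1, so terms with quotient 0 must be left out. The ranges up to `n` lose nothing, since `(s-1)(d-1)+1
≤ n` with `s, d ≥ 2` forces `s, d ≤ n`. -/
theorem theorem2 :
    -- the leaf / degree identity
    (∀ T : RootedTree.{0}, Finite T →
      numLeaves T = 1 + ∑ d ∈ Finset.Icc 1 (Nat.card T), numDeg T d * (d - 1)) ∧
    -- the number of nodes of degree at least `d` in a universal tree
    (∀ n d : ℕ, 1 ≤ n → 2 ≤ d → ∀ U : RootedTree.{0}, Finite U → IsLeafUniversal U n →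
      ∑ s ∈ (Finset.Icc 2 n).filter (fun s => (s - 1) * (d - 1) + 1 ≤ n),
        u (n / ((s - 1) * (d - 1) + 1)) ≤ numDegGe U d) ∧
    -- the recurrence
    (∀ n : ℕ, 1 ≤ n →
      1 + ∑ p ∈ (Finset.Icc 2 n ×ˢ Finset.Icc 2 n).filter
            (fun p => (p.1 - 1) * (p.2 - 1) + 1 ≤ n),
          u (n / ((p.1 - 1) * (p.2 - 1) + 1)) ≤ u n) ∧
    -- the asymptotic bound; the sum is taken in `[0, ∞]`
    (∀ c : ℝ, 1 < ∑' p : ℕ+ × ℕ+, ENNReal.ofReal (((p.1 : ℝ) * (p.2 : ℝ) + 1) ^ (-c)) →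
      (fun n : ℕ => (n : ℝ) ^ c) =O[atTop] (fun n : ℕ => (u n : ℝ))) ∧
    -- the numerical instance, also for the size of minor-universal trees
    (1 < ∑' p : ℕ+ × ℕ+, ENNReal.ofReal (((p.1 : ℝ) * (p.2 : ℝ) + 1) ^ (-(2.174 : ℝ)))) ∧
    ((fun n : ℕ => (n : ℝ) ^ (2.174 : ℝ)) =O[atTop] (fun n : ℕ => (u n : ℝ))) ∧
    ((fun N : ℕ => (N : ℝ) ^ (2.174 : ℝ)) =O[atTop]
      (fun N : ℕ => (minorUniversalSize N : ℝ))) := by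
  refine ⟨fun T _ => numLeaves_eq_one_add_sum_numDeg, fun n d _ hd U _ hU => ?_,
    fun n _ => one_add_sum_u_le_u n, fun c hc => rpow_isBigO_u hc, one_lt_tsum_rpow,
    rpow_isBigO_u one_lt_tsum_rpow,
    rpow_isBigO_minorUniversalSize (by norm_num) (rpow_isBigO_u one_lt_tsum_rpow)⟩
  refine hU.sum_u_le_numDegGe hd _ fun s hs => ?_
  rw [Finset.mem_filter, Finset.mem_Icc] at hs
  exact ⟨hs.1.1, hs.2⟩
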